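/- Let $\mathbb T$ be the unit circle with normalized Lebesgue measure $m$, let $\mathbb D$ be the open unit disc, let $E$ be a complex Hilbert space, and let $\mathcal B(E)$ be the algebra of bounded operators on $E$, with identity $I$. Let $L^\infty(\mathbb T,\mathcal B(E))$ be the space of essentially bounded SOT-measurable functions $\Phi:\mathbb T\to\mathcal B(E)$ (so $\Phi(\cdot)x$ is strongly measurable for every $x\in E$), where $\Phi$ and $\Psi$ are identified if $\Phi(\cdot)x=\Psi(\cdot)x$ a.e. for every $x\in E$ (for separable $E$ this means $\Phi=\Psi$ a.e.). Let $H^\infty(\mathbb T,\mathcal B(E))$ be the set of those $\Phi$ with $\int_{\mathbb T}\bar z^n\Phi(z)x\,dm(z)=0$ for all $n<0$ and $x\in E$, and let $H^2(\mathbb T,E)=\{f\in L^2(\mathbb T,E):\int_{\mathbb T}\bar z^n f(z)\,dm(z)=0\text{ for all }n<0\}$. For $\Psi\in L^\infty(\mathbb T,\mathcal B(E))$ the Hankel operator $H_\Psi$ is defined by $H_\Psi f=JP_-(\Psi f)$, $f\in H^2(\mathbb T,E)$, where $P_-$ is the orthogonal projection of $L^2(\mathbb T,E)$ onto $L^2(\mathbb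 T,E)\ominus H^2(\mathbb T,E)$ and $(Jg)(z)=\bar z g(\bar z)$. For $\alpha\in\mathbb D$ let $b_\alpha(z)=\frac{z-\alpha}{1-\bar\alpha z}$; a finite Blaschke product is a function $\nu\prod_{i=1}^M b_{\alpha_i}$ with $|\nu|=1$, $M\ge 0$ and $\alpha_i\in\mathbb D$. Let $\Phi\in H^\infty(\mathbb T,\mathcal B(E))$ be two-sided inner, i.e. $\Phi^*\Phi=\Phi\Phi^*=I$ a.e. on $\mathbb T$. Call $\Phi$ rational if $\Phi^*\in L^\infty(\mathbb T,\mathcal B(E))$ (which is automatic when $E$ is separable) and $\theta H^2(\mathbb T,E)\subseteq\ker H_{\Phi^*}$ for some finite Blaschke product $\theta$. Then $\Phi$ is rational if and only if it is a finite Blaschke–Potapov product, that is, if and only if there are $M\ge 0$, a unitary operator $V$ on $E$, points $\alpha_1,\dots,\alpha_M\in\mathbb D$ and orthogonal projections $P_1,\dots,P_M$ in $E$ such that, as elements of $L^\infty(\mathbb T,\mathcal B(E))$, $$\Phi=V\prod_{i=1}^M\bigl(b_{\alpha_i}P_i+(I-P_i)\bigr)=V\bigl(b_{\alpha_1}P_1+(I-P_1)\bigr)\cdots\bigl(b_{\alpha_M}P_M+(I-P_M)\bigr).$$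 -/

import Mathlib

open MeasureTheory ContinuousLinearMap
open scoped ComplexConjugate InnerProduct

noncomputable section

namespace OperatorHardy

/-! ### The unit circle with its normalized Lebesgue measure -/

/-- The Borel σ-algebra of the unit circle `𝕋`. -/
instance instMeasurableSpaceCircle : MeasurableSpace Circle := borel Circle

instance instBorelSpaceCircle : BorelSpace Circle := ⟨rfl⟩

/-- The normalized Lebesgue measure `m` on `𝕋`: the image of the Haar probability measure of `ℝ/ℤ`
under `t ↦ exp (2πit)`. -/
def m : Measure Circle :=
  Measure.map (AddCircle.toCircle : UnitAddCircle → Circle) AddCircle.haarAddCircle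

theorem measurable_toCircle : Measurable (AddCircle.toCircle : UnitAddCircle → Circle) :=
  AddCircle.continuous_toCircle.measurable

instance instIsProbabilityMeasureM : IsProbabilityMeasure m :=
  Measure.isProbabilityMeasure_map measurable_toCircle.aemeasurable

theorem measurable_coe : Measurable (fun z : Circle => (z : ℂ)) :=
  by
  have h : Continuous (fun z : Circle => (z : ℂ)) := continuous_subtype_val
  exact h.measurable

/-- Complex conjugation `z ↦ z̄ = z⁻¹` preserves `m`. -/
theorem measurePreserving_inv : MeasurePreserving (fun z : Circle => z⁻¹) m m := by
  refine ⟨continuous_inv.measurable, ?_⟩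
  have hneg : Measure.map (fun t : UnitAddCircle => -t) AddCircle.haarAddCircle
      = AddCircle.haarAddCircle := Measure.map_neg_eq_self _
  unfold m
  rw [Measure.map_map continuous_inv.measurable measurable_toCircle]
  conv_rhs => rw [← hneg]
  rw [Measure.map_map measurable_toCircle measurable_neg]
  congr 1
  funext t
  simp [AddCircle.toCircle_neg]

variable {D E : Type*}
  [NormedAddCommGroup D] [InnerProductSpace ℂ D]
  [NormedAddCommGroup E] [InnerProductSpace ℂ E]

/-! ### Fourier coefficients, `H²(𝕋, E)`, `L^∞` and `H^∞` -/

/-- The `n`-th Fourier coefficient `∫ z̄ⁿ f(z) dm(z)` (a Bochner integral). -/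
def fourierCoefficient (f : Circle → E) (n : ℤ) : E :=
  ∫ z, (conj (z : ℂ)) ^ n • f z ∂m

theorem norm_conj_zpow (z : Circle) (n : ℤ) : ‖(conj (z : ℂ)) ^ n‖ = 1 := by
  rw [norm_zpow, Complex.norm_conj, Circle.norm_coe, one_zpow]

theorem integrable_conj_zpow_smul (f : Lp E 2 m) (n : ℤ) :
    Integrable (fun z : Circle => (conj (z : ℂ)) ^ n • f z) m := by
  have hf : Integrable f m := (Lp.memLp f).integrable (by norm_num)
  refine (integrable_norm_iff ?_).1 (hf.norm.congr (.of_forall fun z => ?_))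
  · exact ((Complex.continuous_conj.measurable.comp measurable_coe).pow_const n
      ).aestronglyMeasurable.smul (Lp.aestronglyMeasurable f)
  · simp only [norm_smul, norm_conj_zpow, one_mul]

/-- The Hardy space `H²(𝕋, E)`, as a subspace of `L²(𝕋, E)`. -/
def H2 (E : Type*) [NormedAddCommGroup E] [InnerProductSpace ℂ E] :
    Submodule ℂ (Lp E 2 m) where
  carrier := {f | ∀ n : ℤ, n < 0 → fourierCoefficient f n = 0}
  zero_mem' := by
    intro n _
    have h : (fun z : Circle => (conj (z : ℂ)) ^ n • (0 : Lp E 2 m) z) =ᵐ[m] fun _ => 0 := by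
      filter_upwards [Lp.coeFn_zero E 2 m] with z hz
      rw [hz, Pi.zero_apply, smul_zero]
    rw [fourierCoefficient, integral_congr_ae h, integral_zero]
  add_mem' := by
    intro f g hf hg n hn
    have h : (fun z : Circle => (conj (z : ℂ)) ^ n • (f + g : Lp E 2 m) z) =ᵐ[m]
        fun z => (conj (z : ℂ)) ^ n • f z + (conj (z : ℂ)) ^ n • g z := by
      filter_upwards [Lp.coeFn_add f g] with z hz
      rw [hz, Pi.add_apply, smul_add]
    rw [fourierCoefficient, integral_congr_ae h,
      integral_add (integrable_conj_zpow_smul f n) (integrable_conj_zpow_smul g n)]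
    have h1 := hf n hn
    have h2 := hg n hn
    rw [fourierCoefficient] at h1 h2
    rw [h1, h2, add_zero]
  smul_mem' := by
    intro c f hf n hn
    have h : (fun z : Circle => (conj (z : ℂ)) ^ n • (c • f : Lp E 2 m) z) =ᵐ[m]
        fun z => c • ((conj (z : ℂ)) ^ n • f z) := by
      filter_upwards [Lp.coeFn_smul c f] with z hz
      rw [hz, Pi.smul_apply, smul_comm]
    have h1 := hf n hn
    rw [fourierCoefficient] at h1 ⊢
    rw [integral_congr_ae h, integral_smul, h1, smul_zero]

/-- `Ψ` is (a representative of) an element of `L^∞(𝕋, B(D,E))`: it is SOT-measurable, which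
means that `Ψ(·)x` is strongly measurable for every `x`, and essentially bounded. -/
def IsLinfty (Ψ : Circle → D →L[ℂ] E) : Prop :=
  (∀ x : D, AEStronglyMeasurable (fun z => Ψ z x) m) ∧ ∃ C : ℝ, ∀ᵐ z ∂m, ‖Ψ z‖ ≤ C

/-- `Φ` is (a representative of) an element of `H^∞(𝕋, B(D,E))`. -/
def IsHinfty (Φ : Circle → D →L[ℂ] E) : Prop :=
  IsLinfty Φ ∧ ∀ n : ℤ, n < 0 → ∀ x : D, fourierCoefficient (fun z => Φ z x) n = 0

/-- Equality in `L^∞(𝕋, B(D,E))` seen as a space of strong functions: `Φ(·)x` and `Ψ(·)x` are the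
same element of `L^∞(𝕋, E)` for every `x`. For separable `D` this is equality almost everywhere,
see `strongEq_iff_ae_eq`. -/
def StrongEq (Φ Ψ : Circle → D →L[ℂ] E) : Prop :=
  ∀ x : D, ∀ᵐ z ∂m, Φ z x = Ψ z x

theorem strongEq_iff_ae_eq [TopologicalSpace.SeparableSpace D] (Φ Ψ : Circle → D →L[ℂ] E) :
    StrongEq Φ Ψ ↔ Φ =ᵐ[m] Ψ := by
  constructor
  · intro h
    have h' : ∀ᵐ z ∂m, ∀ k : ℕ, Φ z (TopologicalSpace.denseSeq D k)
        = Ψ z (TopologicalSpace.denseSeq D k) := ae_all_iff.2 fun k => h _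
    filter_upwards [h'] with z hz
    refine ContinuousLinearMap.coeFn_injective ?_
    exact Continuous.ext_on (TopologicalSpace.denseRange_denseSeq D) (Φ z).continuous
      (Ψ z).continuous (by rintro _ ⟨k, rfl⟩; exact hz k)
  · intro h x
    filter_upwards [h] with z hz
    rw [hz]

/-! ### Multiplication and Hankel operators -/

theorem IsLinfty.aestronglyMeasurable_apply {Ψ : Circle → D →L[ℂ] E} (hΨ : IsLinfty Ψ)
    {f : Circle → D} (hf : AEStronglyMeasurable f m) :
    AEStronglyMeasurable (fun z => Ψ z (f z)) m := by
  have key : ∀ s : SimpleFunc Circle D, AEStronglyMeasurable (fun z => Ψ z (s z)) m := by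
    intro s
    have hs : (fun z => Ψ z (s z)) = fun z => ∑ x ∈ s.range,
        Set.indicator (s ⁻¹' {x}) (fun z => Ψ z x) z := by
      funext z
      rw [Finset.sum_eq_single (s z)]
      · simp
      · intro x _ hx
        exact Set.indicator_of_notMem (fun h => hx h.symm) _
      · intro h
        exact absurd (s.mem_range_self z) h
    rw [hs]
    refine Finset.aestronglyMeasurable_fun_sum _ fun x _ => ?_
    exact (hΨ.1 x).indicator (s.measurableSet_preimage _)
  refine aestronglyMeasurable_of_tendsto_ae Filter.atTop
    (fun k => key (hf.stronglyMeasurable_mk.approx k)) ?_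
  filter_upwards [hf.ae_eq_mk] with z hz
  rw [hz]
  exact ((Ψ z).continuous.tendsto _).comp (hf.stronglyMeasurable_mk.tendsto_approx z)

theorem IsLinfty.memLp_apply {Ψ : Circle → D →L[ℂ] E} (hΨ : IsLinfty Ψ) (f : Lp D 2 m) :
    MemLp (fun z => Ψ z (f z)) 2 m := by
  obtain ⟨C, hC⟩ := hΨ.2
  refine (Lp.memLp f).of_le_mul (c := C)
    (hΨ.aestronglyMeasurable_apply (Lp.aestronglyMeasurable f)) ?_
  filter_upwards [hC] with z hz
  exact (Ψ z).le_of_opNorm_le hz _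

/-- Multiplication `f ↦ Ψ f` from `L²(𝕋, D)` to `L²(𝕋, E)` by `Ψ ∈ L^∞(𝕋, B(D,E))`. -/
def multiplication (Ψ : Circle → D →L[ℂ] E) (hΨ : IsLinfty Ψ) : Lp D 2 m →ₗ[ℂ] Lp E 2 m where
  toFun f := (hΨ.memLp_apply f).toLp
  map_add' f g := by
    rw [← MemLp.toLp_add]
    refine MemLp.toLp_congr _ _ ?_
    filter_upwards [Lp.coeFn_add f g] with z hz
    rw [hz, Pi.add_apply, map_add, Pi.add_apply]
  map_smul' c f := by
    rw [RingHom.id_apply, ← MemLp.toLp_const_smul]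
    refine MemLp.toLp_congr _ _ ?_
    filter_upwards [Lp.coeFn_smul c f] with z hz
    rw [hz, Pi.smul_apply, map_smul, Pi.smul_apply]

/-- A bounded measurable scalar function `θ`, seen as the operator-valued function `θ I_E`,
belongs to `L^∞`. -/
theorem isLinfty_scalar {θ : Circle → ℂ} (hθ : Measurable θ) (hb : ∀ z, ‖θ z‖ ≤ 1) :
    IsLinfty (fun z => θ z • (1 : E →L[ℂ] E)) := by
  refine ⟨fun x => ?_, 1, .of_forall fun z => ?_⟩
  · simpa using hθ.aestronglyMeasurable.smul_const x
  · rw [norm_smul]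
    exact mul_le_one₀ (hb z) (norm_nonneg _) norm_id_le

theorem isLinfty_conj : IsLinfty (fun z : Circle => conj (z : ℂ) • (1 : E →L[ℂ] E)) :=
  isLinfty_scalar (Complex.continuous_conj.measurable.comp measurable_coe) fun z => by
    rw [Complex.norm_conj, Circle.norm_coe]

/-- The unitary operator `J` on `L²(𝕋, E)`, `(Jg)(z) = z̄ g(z̄)`. -/
def flip (E : Type*) [NormedAddCommGroup E] [InnerProductSpace ℂ E] :
    Lp E 2 m →ₗ[ℂ] Lp E 2 m :=
  multiplication (fun z : Circle => conj (z : ℂ) • (1 : E →L[ℂ] E)) isLinfty_conj ∘ₗ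
    (Lp.compMeasurePreservingₗᵢ ℂ (fun z : Circle => z⁻¹) measurePreserving_inv).toLinearMap

/-- The orthogonal projection `P₋` of `L²(𝕋, E)` onto `L²(𝕋, E) ⊖ H²(𝕋, E)`. -/
def projMinus (E : Type*) [NormedAddCommGroup E] [InnerProductSpace ℂ E] [CompleteSpace E] :
    Lp E 2 m →L[ℂ] Lp E 2 m :=
  (H2 E)ᗮ.starProjection

/-- The Hankel operator `H_Ψ f = J P₋ (Ψ f)`, `f ∈ H²(𝕋, D)`, with symbol
`Ψ ∈ L^∞(𝕋, B(D,E))`. Its values, which lie in `H²(𝕋, E)`, are regarded as elements of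
`L²(𝕋, E)`. -/
def hankel [CompleteSpace E] (Ψ : Circle → D →L[ℂ] E) (hΨ : IsLinfty Ψ) :
    H2 D →ₗ[ℂ] Lp E 2 m :=
  flip E ∘ₗ (projMinus E).toLinearMap ∘ₗ multiplication Ψ hΨ ∘ₗ (H2 D).subtype

/-! ### Blaschke products and rational functions -/

/-- `b_α(z) = (z - α) / (1 - ᾱ z)`. -/
def blaschkeFactor (α : ℂ) (z : Circle) : ℂ := ((z : ℂ) - α) / (1 - conj α * (z : ℂ))

/-- Finite Blaschke products `ν ∏ b_{α_i}` with `|ν| = 1` and `α_i` in the open unit disc. -/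
def IsFiniteBlaschkeProduct (θ : Circle → ℂ) : Prop :=
  ∃ (ν : ℂ) (M : ℕ) (α : Fin M → ℂ), ‖ν‖ = 1 ∧ (∀ i, ‖α i‖ < 1) ∧
    ∀ z, θ z = ν * ∏ i, blaschkeFactor (α i) z

theorem norm_blaschkeFactor {α : ℂ} (hα : ‖α‖ < 1) (z : Circle) : ‖blaschkeFactor α z‖ = 1 := by
  have hz : conj (z : ℂ) * (z : ℂ) = 1 := by
    rw [← Complex.normSq_eq_conj_mul_self]; simp
  have h1 : conj (1 - conj α * (z : ℂ)) * (z : ℂ) = (z : ℂ) - α := by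
    simp only [map_sub, map_one, map_mul, Complex.conj_conj]
    linear_combination (-α) * hz
  have h2 : ‖1 - conj α * (z : ℂ)‖ = ‖(z : ℂ) - α‖ := by
    rw [← h1, norm_mul, Complex.norm_conj, Circle.norm_coe, mul_one]
  have h3 : ‖(z : ℂ) - α‖ ≠ 0 := by
    intro h
    rw [norm_eq_zero, sub_eq_zero] at h
    rw [← h, Circle.norm_coe] at hα
    exact lt_irrefl _ hα
  rw [blaschkeFactor, norm_div, h2, div_self h3]

theorem IsFiniteBlaschkeProduct.isLinfty {θ : Circle → ℂ} (hθ : IsFiniteBlaschkeProduct θ) :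
    IsLinfty (fun z => θ z • (1 : E →L[ℂ] E)) := by
  obtain ⟨ν, M, α, hν, hα, h⟩ := hθ
  refine isLinfty_scalar ?_ fun z => ?_
  · rw [funext h]
    refine measurable_const.mul (Finset.measurable_fun_prod _ fun i _ => ?_)
    exact (measurable_coe.sub_const _).div (measurable_const.sub (measurable_coe.const_mul _))
  · rw [h, norm_mul, hν, norm_prod, Finset.prod_congr rfl fun i _ => norm_blaschkeFactor (hα i) z]
    simp

/-- `Φ` is rational: `θ H²(𝕋, E) ⊆ ker H_{Φ*}` for some finite Blaschke product `θ`.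
The condition `IsLinfty (fun z => (Φ z)†)` only says that the symbol `Φ*` of the Hankel operator
is an element of `L^∞(𝕋, B(E,D))`; for `Φ ∈ L^∞(𝕋, B(D,E))` it is automatic when `D` is
separable, see `IsLinfty.adjoint`. -/
def IsRational [CompleteSpace D] [CompleteSpace E] (Φ : Circle → D →L[ℂ] E) : Prop :=
  ∃ hΦ : IsLinfty (fun z => (Φ z)†), ∃ (θ : Circle → ℂ) (hθ : IsFiniteBlaschkeProduct θ),
    (H2 E).map (multiplication (fun z => θ z • (1 : E →L[ℂ] E)) hθ.isLinfty) ≤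
      (LinearMap.ker (hankel (fun z => (Φ z)†) hΦ)).map (H2 E).subtype

theorem IsLinfty.adjoint [CompleteSpace D] [CompleteSpace E] [TopologicalSpace.SeparableSpace D]
    {Φ : Circle → D →L[ℂ] E} (hΦ : IsLinfty Φ) : IsLinfty (fun z => (Φ z)†) := by
  refine ⟨fun y => ?_, ?_⟩
  · obtain ⟨w, b, -⟩ := exists_hilbertBasis ℂ D
    have hw : Countable w := by
      rw [← Set.countable_univ_iff]
      refine Set.PairwiseDisjoint.countable_of_isOpen
        (s := fun i => Metric.ball (b i) (1 / 2)) ?_ (fun _ _ => Metric.isOpen_ball)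
        (fun i _ => ⟨b i, Metric.mem_ball_self (by norm_num)⟩)
      intro i _ j _ hij
      refine Metric.ball_disjoint_ball ?_
      have h2 : dist (b i) (b j) * dist (b i) (b j) = 2 := by
        rw [dist_eq_norm, @norm_sub_mul_self ℂ, b.orthonormal.2 hij, b.orthonormal.1,
          b.orthonormal.1]
        norm_num
      nlinarith [dist_nonneg (x := b i) (y := b j)]
    refine aestronglyMeasurable_of_tendsto_ae Filter.atTop (f := fun (s : Finset w) z =>
      ∑ i ∈ s, b.repr (((Φ z)†) y) i • b i) (fun s => ?_)
      (.of_forall fun z => b.hasSum_repr (((Φ z)†) y))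
    refine Finset.aestronglyMeasurable_fun_sum _ fun i _ => ?_
    simp only [HilbertBasis.repr_apply_apply, adjoint_inner_right]
    exact ((hΦ.1 (b i)).inner aestronglyMeasurable_const).smul_const _
  · obtain ⟨C, hC⟩ := hΦ.2
    refine ⟨C, ?_⟩
    filter_upwards [hC] with z hz
    simpa using hz

/-! ### Two-sided inner functions and Blaschke-Potapov products -/

/-- `Φ ∈ H^∞(𝕋, B(D,E))` is two-sided inner: `Φ*Φ = I_D` and `ΦΦ* = I_E` a.e. on `𝕋`. -/
def IsTwoSidedInner [CompleteSpace D] [CompleteSpace E] (Φ : Circle → D →L[ℂ] E) : Prop :=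
  IsHinfty Φ ∧ (∀ᵐ z ∂m, (Φ z)† ∘L Φ z = 1) ∧ ∀ᵐ z ∂m, Φ z ∘L (Φ z)† = 1

/-- The operator-valued Blaschke-Potapov factor `b_α P + (I - P)`. -/
def potapovFactor (α : ℂ) (P : E →L[ℂ] E) (z : Circle) : E →L[ℂ] E :=
  blaschkeFactor α z • P + (1 - P)

/-- `Δ` is a finite Blaschke-Potapov product
`V (b_{α_1} P_1 + (I - P_1)) ⋯ (b_{α_M} P_M + (I - P_M))` with `V` unitary, `α_i` in the open unit
disc and `P_i` orthogonal projections in `E`. -/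
def IsFiniteBlaschkePotapovProduct [CompleteSpace E] (Δ : Circle → E →L[ℂ] E) : Prop :=
  ∃ (V : E →L[ℂ] E) (M : ℕ) (α : Fin M → ℂ) (P : Fin M → E →L[ℂ] E),
    V ∈ unitary (E →L[ℂ] E) ∧ (∀ i, ‖α i‖ < 1) ∧ (∀ i, IsStarProjection (P i)) ∧
      ∀ z, Δ z = V * (List.ofFn fun i => potapovFactor (α i) (P i) z).prod

end OperatorHardy

end

/-!
Write `Φ(α)` for the value at `α ∈ 𝔻` of the holomorphic extension of `Φ ∈ H^∞`, a Cauchy integral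
over the circle (`diskEval`). Two facts about `H²(𝕋, E)` carry the argument. An element of `H²`
vanishes at `α` exactly when it is `b_α` times an element of `H²`
(`diskEval_blaschkeFactor_smul`, `IsH2.conj_blaschkeFactor_smul`); both directions come from
two-term recursions for Fourier coefficients, whose solutions vanish because they are bounded and
`|α| < 1`. And `Φ ∈ H^∞` maps `H²` into itself with `(Φ f)(α) = Φ(α) f(α)` (`IsHinfty.isH2_apply`,
`IsHinfty.diskEval_apply`), by density of the analytic polynomials.

Since `J` is injective and `H²` is closed, `Φ` is rational if and only if `θ Φ* H² ⊆ H²` for some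
`θ = ∏ b_{α_i}` (`isRational_iff`); the unimodular constant of the Blaschke product plays no role.

If `Φ` is rational, its Potapov factors are split off one at a time
(`exists_potapovFactor_right`). Let `θ = b_α θ'` and let `P` be the orthogonal projection onto
`ker Φ(α)`. Then `Φ' = Φ (b̄_α P + (I - P))` is analytic because `Φ(α) P = 0`. For `f ∈ H²` the
function `h = θ Φ* f` satisfies `Φ(α) h(α) = (θ f)(α) = 0`, so `(I - P) h` vanishes at `α`, and
`θ' Φ'* f = P h + b̄_α (I - P) h` belongs to `H²`. When no factor of `θ` is left, `Φ` and `Φ*` are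
both analytic, hence `Φ` is a constant unitary operator (`exists_unitary_of_isHinfty_adjoint`).

Conversely, for a Blaschke-Potapov product `Δ` with parameters `α_i`, `P_i` the function
`∏ b_{α_i} Δ*` is a product of the analytic functions `P_i + b_{α_i} (I - P_i)` and a constant. For
nonseparable `E` it has to be seen that strong equality of `Φ` and `Δ` passes to the adjoints
(`StrongEq.adjoint`).
-/

open scoped InnerProductSpace

noncomputable section

namespace OperatorHardy

variable {D E : Type*}
  [NormedAddCommGroup D] [InnerProductSpace ℂ D]
  [NormedAddCommGroup E] [InnerProductSpace ℂ E]

/-! ### Square-integrable functions and their Fourier coefficients -/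

theorem conj_coe_eq_inv (z : Circle) : conj (z : ℂ) = (z : ℂ)⁻¹ := by
  rw [← Circle.coe_inv_eq_conj, Circle.coe_inv]

theorem continuous_coe_circle : Continuous (fun z : Circle => (z : ℂ)) :=
  continuous_subtype_val

theorem memLp_continuous_smul {θ : Circle → ℂ} (hθ : Continuous θ) {f : Circle → E}
    (hf : MemLp f 2 m) : MemLp (fun z => θ z • f z) 2 m := by
  obtain ⟨C, hC⟩ := isCompact_univ.exists_bound_of_continuousOn hθ.continuousOn
  refine hf.of_le_mul (c := C) (hθ.measurable.aestronglyMeasurable.smul hf.1) ?_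
  refine .of_forall fun z => ?_
  rw [norm_smul]
  exact mul_le_mul_of_nonneg_right (hC z (Set.mem_univ z)) (norm_nonneg _)

theorem continuous_conj_zpow (n : ℤ) : Continuous (fun z : Circle => (conj (z : ℂ)) ^ n) :=
  (Complex.continuous_conj.comp continuous_coe_circle).zpow₀ n fun z => Or.inl (by simp)

theorem integrable_conj_zpow_smul_of_memLp {f : Circle → E} (hf : MemLp f 2 m) (n : ℤ) :
    Integrable (fun z : Circle => (conj (z : ℂ)) ^ n • f z) m :=
  (memLp_continuous_smul (continuous_conj_zpow n) hf).integrable (by norm_num)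

theorem fourierCoefficient_congr_ae {f g : Circle → E} (h : f =ᵐ[m] g) (n : ℤ) :
    fourierCoefficient f n = fourierCoefficient g n := by
  refine integral_congr_ae ?_
  filter_upwards [h] with z hz
  rw [hz]

theorem fourierCoefficient_add {f g : Circle → E} (hf : MemLp f 2 m) (hg : MemLp g 2 m) (n : ℤ) :
    fourierCoefficient (fun z => f z + g z) n
      = fourierCoefficient f n + fourierCoefficient g n := by
  simp only [fourierCoefficient, smul_add]
  exact integral_add (integrable_conj_zpow_smul_of_memLp hf n)
    (integrable_conj_zpow_smul_of_memLp hg n)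

theorem fourierCoefficient_const_smul (f : Circle → E) (c : ℂ) (n : ℤ) :
    fourierCoefficient (fun z => c • f z) n = c • fourierCoefficient f n := by
  simp only [fourierCoefficient, smul_comm _ c]
  exact integral_smul _ _

theorem fourierCoefficient_clm [CompleteSpace D] [CompleteSpace E] (A : D →L[ℂ] E)
    {f : Circle → D} (hf : MemLp f 2 m) (n : ℤ) :
    fourierCoefficient (fun z => A (f z)) n = A (fourierCoefficient f n) := by
  simp only [fourierCoefficient]
  rw [← A.integral_comp_comm (integrable_conj_zpow_smul_of_memLp hf n)]
  simp

theorem fourierCoefficient_zpow_smul (f : Circle → E) (k n : ℤ) :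
    fourierCoefficient (fun z => (z : ℂ) ^ k • f z) n = fourierCoefficient f (n - k) := by
  refine integral_congr_ae (.of_forall fun z => ?_)
  have hz : (z : ℂ) ≠ 0 := Circle.coe_ne_zero z
  simp only [smul_smul]
  rw [conj_coe_eq_inv, inv_zpow, inv_zpow, ← zpow_neg, ← zpow_neg, ← zpow_add₀ hz]
  congr 2
  ring

/-- Multiplication by a polynomial of degree one is a two-term recursion for the Fourier
coefficients. -/
theorem fourierCoefficient_affine_smul {f : Circle → E} (hf : MemLp f 2 m) (a b : ℂ) (n : ℤ) :
    fourierCoefficient (fun z => (a + b * (z : ℂ)) • f z) n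
      = a • fourierCoefficient f n + b • fourierCoefficient f (n - 1) := by
  have h := fourierCoefficient_zpow_smul f 1 n
  simp only [zpow_one] at h
  rw [← h, ← fourierCoefficient_const_smul, ← fourierCoefficient_const_smul,
    ← fourierCoefficient_add]
  · simp only [add_smul, mul_smul]
  · exact hf.const_smul a
  · exact (memLp_continuous_smul continuous_coe_circle hf).const_smul b

theorem norm_fourierCoefficient_le (f : Circle → E) (n : ℤ) :
    ‖fourierCoefficient f n‖ ≤ ∫ z, ‖f z‖ ∂m := by
  refine (norm_integral_le_integral_norm _).trans (le_of_eq ?_)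
  simp only [norm_smul, norm_conj_zpow, one_mul]

/-- A bounded sequence with `u k = β u (k + 1)` and `|β| < 1` vanishes. -/
theorem eq_zero_of_bounded_of_eq_smul_succ {u : ℕ → E} {β : ℂ} (hβ : ‖β‖ < 1) {C : ℝ}
    (hC : ∀ k, ‖u k‖ ≤ C) (hu : ∀ k, u k = β • u (k + 1)) (k : ℕ) : u k = 0 := by
  have h1 : ∀ j, u k = β ^ j • u (k + j) := by
    intro j
    induction j with
    | zero => simp
    | succ j ih => rw [ih, hu (k + j), smul_smul, pow_succ]; rfl
  have h2 : ∀ j, ‖u k‖ ≤ ‖β‖ ^ j * C := by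
    intro j
    rw [h1 j, norm_smul, norm_pow]
    exact mul_le_mul_of_nonneg_left (hC _) (by positivity)
  have h3 : Filter.Tendsto (fun j => ‖β‖ ^ j * C) Filter.atTop (nhds 0) := by
    simpa using (tendsto_pow_atTop_nhds_zero_of_lt_one (norm_nonneg β) hβ).mul_const C
  exact norm_le_zero_iff.1 (ge_of_tendsto' h3 h2)

theorem measurableEmbedding_toCircle :
    MeasurableEmbedding (AddCircle.toCircle : UnitAddCircle → Circle) :=
  (AddCircle.continuous_toCircle.isClosedEmbedding
    (AddCircle.injective_toCircle one_ne_zero)).measurableEmbedding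

/-- The coefficients in the sense of `fourierCoefficient` agree with those of Mathlib after
transport to the additive circle. -/
theorem fourierCoefficient_eq_fourierCoeff (f : Circle → E) (n : ℤ) :
    fourierCoefficient f n
      = fourierCoeff (fun t : UnitAddCircle => f (AddCircle.toCircle t)) n := by
  rw [fourierCoefficient, m, measurableEmbedding_toCircle.integral_map, fourierCoeff]
  refine integral_congr_ae (.of_forall fun t => ?_)
  simp only [fourier_apply, AddCircle.toCircle_zsmul, conj_coe_eq_inv,
    inv_zpow, neg_smul, Circle.coe_inv, Circle.coe_zpow, AddCircle.toCircle_neg]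

theorem fourierCoefficient_const [CompleteSpace E] (x : E) (n : ℤ) :
    fourierCoefficient (fun _ => x) n = if n = 0 then x else 0 := by
  have h1 : fourierCoefficient (fun _ : Circle => (1 : ℂ)) n =
      Pi.single (M := fun _ => ℂ) 0 1 n := by
    rw [fourierCoefficient_eq_fourierCoeff, ← fourierCoeff_fourier (T := 1) 0]
    congr 1
    funext t
    simp
  have h2 := fourierCoefficient_clm (ContinuousLinearMap.toSpanSingleton ℂ x)
    (f := fun _ : Circle => (1 : ℂ)) (memLp_const 1) n
  simp only [h1, toSpanSingleton_apply, one_smul] at h2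
  rw [h2]
  split_ifs with h
  · simp [h]
  · simp [h]

theorem ae_eq_zero_of_fourierCoefficient_eq_zero_scalar {f : Circle → ℂ} (hf : MemLp f 2 m)
    (h : ∀ n, fourierCoefficient f n = 0) : f =ᵐ[m] 0 := by
  have hmp : MeasurePreserving (AddCircle.toCircle : UnitAddCircle → Circle)
      AddCircle.haarAddCircle m := ⟨measurable_toCircle, rfl⟩
  have hg : MemLp (fun t : UnitAddCircle => f (AddCircle.toCircle t)) 2
      AddCircle.haarAddCircle := hf.comp_measurePreserving hmp
  have h0 : hg.toLp = 0 := by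
    refine fourierBasis.repr.injective ?_
    ext n
    rw [fourierBasis_repr, fourierCoeff_congr_ae hg.coeFn_toLp,
      ← fourierCoefficient_eq_fourierCoeff, h n]
    simp
  have h1 := (MemLp.toLp_eq_toLp_iff hg (MemLp.zero)).1 (h0.trans (MemLp.toLp_zero _).symm)
  unfold m
  exact (measurableEmbedding_toCircle.ae_map_iff).2 h1

/-- Vector-valued square-integrable functions are determined by their Fourier coefficients. -/
theorem ae_eq_zero_of_fourierCoefficient_eq_zero [CompleteSpace E] {f : Circle → E}
    (hf : MemLp f 2 m) (h : ∀ n, fourierCoefficient f n = 0) : f =ᵐ[m] 0 := by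
  obtain ⟨t, ht, hft⟩ := hf.1.isSeparable_ae_range
  refine ae_eq_zero_of_forall_dual_of_isSeparable ℂ ht (fun c => ?_) hft
  refine ae_eq_zero_of_fourierCoefficient_eq_zero_scalar (c.comp_memLp' hf) fun n => ?_
  have := fourierCoefficient_clm c hf n
  rw [h n, map_zero] at this
  exact this

/-! ### Hardy functions and Blaschke factors -/

/-- `f` is a representative of an element of `H²(𝕋, E)`. Functions are used in place of classes
in `Lp`, so that pointwise products need no coercions. -/
def IsH2 (f : Circle → E) : Prop :=
  MemLp f 2 m ∧ ∀ n : ℤ, n < 0 → fourierCoefficient f n = 0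

theorem isH2_coeFn {f : Lp E 2 m} : IsH2 (f : Circle → E) ↔ f ∈ H2 E :=
  ⟨fun h => h.2, fun h => ⟨Lp.memLp f, h⟩⟩

theorem IsH2.congr {f g : Circle → E} (hf : IsH2 f) (h : f =ᵐ[m] g) : IsH2 g :=
  ⟨(memLp_congr_ae h).1 hf.1, fun n hn => by
    rw [← fourierCoefficient_congr_ae h, hf.2 n hn]⟩

theorem IsH2.add {f g : Circle → E} (hf : IsH2 f) (hg : IsH2 g) : IsH2 (fun z => f z + g z) :=
  ⟨hf.1.add hg.1, fun n hn => by
    rw [fourierCoefficient_add hf.1 hg.1, hf.2 n hn, hg.2 n hn, add_zero]⟩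

theorem IsH2.const_smul {f : Circle → E} (hf : IsH2 f) (c : ℂ) : IsH2 (fun z => c • f z) :=
  ⟨hf.1.const_smul c, fun n hn => by
    rw [fourierCoefficient_const_smul, hf.2 n hn, smul_zero]⟩

theorem IsH2.clm [CompleteSpace D] [CompleteSpace E] {f : Circle → D} (hf : IsH2 f)
    (A : D →L[ℂ] E) : IsH2 (fun z => A (f z)) :=
  ⟨A.comp_memLp' hf.1, fun n hn => by
    rw [fourierCoefficient_clm A hf.1, hf.2 n hn, map_zero]⟩

theorem isH2_const [CompleteSpace E] (x : E) : IsH2 (fun _ : Circle => x) :=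
  ⟨memLp_const x, fun n hn => by rw [fourierCoefficient_const, if_neg hn.ne]⟩

theorem IsH2.sub {f g : Circle → E} (hf : IsH2 f) (hg : IsH2 g) : IsH2 (fun z => f z - g z) := by
  refine (hf.add (hg.const_smul (-1))).congr (.of_forall fun z => ?_)
  simp [sub_eq_add_neg]

theorem IsH2.affine_smul {f : Circle → E} (hf : IsH2 f) (a b : ℂ) :
    IsH2 (fun z => (a + b * (z : ℂ)) • f z) :=
  ⟨memLp_continuous_smul (continuous_const.add (continuous_const.mul continuous_coe_circle)) hf.1,
    fun n hn => by
      rw [fourierCoefficient_affine_smul hf.1, hf.2 n hn, hf.2 (n - 1) (by omega), smul_zero,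
        smul_zero, add_zero]⟩

theorem IsH2.zpow_smul {f : Circle → E} (hf : IsH2 f) {k : ℤ} (hk : 0 ≤ k) :
    IsH2 (fun z => (z : ℂ) ^ k • f z) :=
  ⟨memLp_continuous_smul (continuous_coe_circle.zpow₀ k fun z => Or.inl (Circle.coe_ne_zero z))
    hf.1, fun n hn => by rw [fourierCoefficient_zpow_smul, hf.2 _ (by omega)]⟩

section BlaschkeFactor

variable {α : ℂ}

theorem one_sub_conj_mul_ne_zero (hα : ‖α‖ < 1) (z : Circle) : 1 - conj α * (z : ℂ) ≠ 0 := by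
  intro h
  have h1 : ‖conj α * (z : ℂ)‖ = 1 := by rw [← sub_eq_zero.1 h, norm_one]
  rw [norm_mul, Complex.norm_conj, Circle.norm_coe, mul_one] at h1
  exact hα.ne h1

theorem sub_ne_zero_of_norm_lt_one (hα : ‖α‖ < 1) (z : Circle) : (z : ℂ) - α ≠ 0 := by
  intro h
  rw [← sub_eq_zero.1 h, Circle.norm_coe] at hα
  exact lt_irrefl _ hα

theorem one_sub_mul_conj_ne_zero (hα : ‖α‖ < 1) (z : Circle) : 1 - α * conj (z : ℂ) ≠ 0 := by
  intro h
  apply one_sub_conj_mul_ne_zero hα z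
  have := congrArg conj h
  simpa using this

theorem continuous_cauchyKernel (hα : ‖α‖ < 1) :
    Continuous (fun z : Circle => (1 - α * conj (z : ℂ))⁻¹) :=
  (continuous_const.sub (continuous_const.mul
    (Complex.continuous_conj.comp continuous_coe_circle))).inv₀ (one_sub_mul_conj_ne_zero hα)

theorem continuous_blaschkeFactor (hα : ‖α‖ < 1) : Continuous (blaschkeFactor α) :=
  (continuous_coe_circle.sub continuous_const).div
    (continuous_const.sub (continuous_const.mul continuous_coe_circle))
    (one_sub_conj_mul_ne_zero hα)

theorem conj_blaschkeFactor_mul_self (hα : ‖α‖ < 1) (z : Circle) :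
    conj (blaschkeFactor α z) * blaschkeFactor α z = 1 := by
  rw [← Complex.normSq_eq_conj_mul_self, Complex.normSq_eq_norm_sq, norm_blaschkeFactor hα]
  simp

theorem conj_blaschkeFactor (hα : ‖α‖ < 1) (z : Circle) :
    conj (blaschkeFactor α z) = (1 - conj α * (z : ℂ)) / ((z : ℂ) - α) := by
  rw [eq_inv_of_mul_eq_one_left (conj_blaschkeFactor_mul_self hα z), blaschkeFactor, inv_div]

/-- `H²` is stable under division by `1 - ᾱ z`: the coefficients of the quotient satisfy
`ĝ(n) = ᾱ ĝ(n-1)` for `n < 0`, hence vanish there. -/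
theorem IsH2.div_one_sub (hα : ‖α‖ < 1) {f : Circle → E} (hf : IsH2 f) :
    IsH2 (fun z => (1 - conj α * (z : ℂ))⁻¹ • f z) := by
  set g : Circle → E := fun z => (1 - conj α * (z : ℂ))⁻¹ • f z with hg
  have hgm : MemLp g 2 m := memLp_continuous_smul ((continuous_const.sub
    (continuous_const.mul continuous_coe_circle)).inv₀ (one_sub_conj_mul_ne_zero hα)) hf.1
  refine ⟨hgm, fun n hn => ?_⟩
  have hrec : ∀ n : ℤ, n < 0 →
      fourierCoefficient g n = conj α • fourierCoefficient g (n - 1) := by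
    intro n hn
    have h1 := fourierCoefficient_affine_smul hgm 1 (-conj α) n
    have h2 : (fun z : Circle => (1 + -conj α * (z : ℂ)) • g z) = f := by
      funext z
      rw [hg, smul_smul, neg_mul, ← sub_eq_add_neg,
        mul_inv_cancel₀ (one_sub_conj_mul_ne_zero hα z), one_smul]
    rw [h2, hf.2 n hn, one_smul, neg_smul, ← sub_eq_add_neg] at h1
    exact (sub_eq_zero.1 h1.symm)
  have := eq_zero_of_bounded_of_eq_smul_succ (u := fun k : ℕ => fourierCoefficient g (n - k))
    (β := conj α) (by simpa using hα) (fun k => norm_fourierCoefficient_le g _) (fun k => by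
      rw [hrec _ (by omega)]
      congr 2
      push_cast
      ring) 0
  simpa using this

/-- The value at `α ∈ 𝔻` of the holomorphic extension of `f ∈ H²(𝕋, E)`, given by the Cauchy
integral `∫ f(z) / (1 - α z̄) dm(z)`. -/
def diskEval (α : ℂ) (f : Circle → E) : E :=
  ∫ z, (1 - α * conj (z : ℂ))⁻¹ • f z ∂m

theorem diskEval_eq_fourierCoefficient (α : ℂ) (f : Circle → E) :
    diskEval α f = fourierCoefficient (fun z => (1 - α * conj (z : ℂ))⁻¹ • f z) 0 := by
  simp [diskEval, fourierCoefficient]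

theorem diskEval_congr_ae {f g : Circle → E} (h : f =ᵐ[m] g) : diskEval α f = diskEval α g := by
  refine integral_congr_ae ?_
  filter_upwards [h] with z hz
  rw [hz]

theorem diskEval_add (hα : ‖α‖ < 1) {f g : Circle → E} (hf : MemLp f 2 m) (hg : MemLp g 2 m) :
    diskEval α (fun z => f z + g z) = diskEval α f + diskEval α g := by
  simp only [diskEval, smul_add]
  exact integral_add
    ((memLp_continuous_smul (continuous_cauchyKernel hα) hf).integrable (by norm_num))
    ((memLp_continuous_smul (continuous_cauchyKernel hα) hg).integrable (by norm_num))

theorem diskEval_const_smul (f : Circle → E) (c : ℂ) :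
    diskEval α (fun z => c • f z) = c • diskEval α f := by
  simp only [diskEval, smul_comm _ c]
  exact integral_smul _ _

theorem diskEval_clm [CompleteSpace D] [CompleteSpace E] (hα : ‖α‖ < 1) (A : D →L[ℂ] E)
    {f : Circle → D} (hf : MemLp f 2 m) :
    diskEval α (fun z => A (f z)) = A (diskEval α f) := by
  simp only [diskEval]
  rw [← A.integral_comp_comm
    ((memLp_continuous_smul (continuous_cauchyKernel hα) hf).integrable (by norm_num))]
  simp

theorem diskEval_const [CompleteSpace E] (hα : ‖α‖ < 1) (x : E) :
    diskEval α (fun _ => x) = x := by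
  rw [diskEval_eq_fourierCoefficient]
  set g : Circle → E := fun z => (1 - α * conj (z : ℂ))⁻¹ • x with hg
  have hgm : MemLp g 2 m :=
    memLp_continuous_smul (continuous_cauchyKernel hα) (memLp_const x)
  -- `(z - α) g = z x` gives `ĝ(n) = α ĝ(n + 1) + (x if n = 0 else 0)`.
  have hrec : ∀ n : ℤ, fourierCoefficient g n
      = α • fourierCoefficient g (n + 1) + if n = 0 then x else 0 := by
    intro n
    have h1 := fourierCoefficient_affine_smul hgm (-α) 1 (n + 1)
    have h2 : (fun z : Circle => (-α + 1 * (z : ℂ)) • g z) =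
        fun z : Circle => (z : ℂ) ^ (1 : ℤ) • x := by
      funext z
      rw [hg, smul_smul, zpow_one, ← div_eq_mul_inv]
      congr 1
      rw [div_eq_iff (one_sub_mul_conj_ne_zero hα z), conj_coe_eq_inv]
      have := Circle.coe_ne_zero z
      field_simp
      ring
    rw [h2, fourierCoefficient_zpow_smul, add_sub_cancel_right, fourierCoefficient_const,
      one_smul] at h1
    rw [h1, neg_smul]
    abel
  have hz := eq_zero_of_bounded_of_eq_smul_succ (u := fun k : ℕ => fourierCoefficient g (k + 1))
    hα (fun k => norm_fourierCoefficient_le g _) (fun k => by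
      rw [hrec, if_neg (by omega), add_zero]
      push_cast
      rfl) 0
  rw [hrec 0, if_pos rfl]
  simp only [Nat.cast_zero] at hz
  rw [hz, smul_zero, zero_add]

/-- Blaschke factors act on `H²`. -/
theorem IsH2.blaschkeFactor_smul (hα : ‖α‖ < 1) {f : Circle → E} (hf : IsH2 f) :
    IsH2 (fun z => blaschkeFactor α z • f z) := by
  refine ((hf.div_one_sub hα).affine_smul (-α) 1).congr (.of_forall fun z => ?_)
  simp only [blaschkeFactor, smul_smul, div_eq_mul_inv]
  congr 2
  ring

/-- `b_α f` vanishes at `α`: since `b_α(z) / (1 - α z̄) = z / (1 - ᾱ z)`, its Cauchy integral is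
a Fourier coefficient of index `-1` of an element of `H²`. -/
theorem diskEval_blaschkeFactor_smul (hα : ‖α‖ < 1) {f : Circle → E} (hf : IsH2 f) :
    diskEval α (fun z => blaschkeFactor α z • f z) = 0 := by
  have h := (hf.div_one_sub hα).2 (0 - 1) (by norm_num)
  rw [← fourierCoefficient_zpow_smul] at h
  rw [diskEval_eq_fourierCoefficient, ← h]
  congr 1
  funext z
  rw [smul_smul, smul_smul, zpow_one, blaschkeFactor]
  congr 1
  have h1 := one_sub_mul_conj_ne_zero hα z
  have h2 := one_sub_conj_mul_ne_zero hα z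
  have h3 := Circle.coe_ne_zero z
  rw [inv_mul_eq_div, div_eq_iff h1, ← div_eq_mul_inv, div_mul_eq_mul_div]
  congr 1
  rw [conj_coe_eq_inv]
  field_simp

/-- An element of `H²` that vanishes at `α` is divisible by `b_α`: the coefficients of
`g = f / (z - α)` satisfy `ĝ(n-1) = α ĝ(n)` for `n < 0`, and `ĝ(-1)` is the value of `f` at `α`. -/
theorem IsH2.conj_blaschkeFactor_smul (hα : ‖α‖ < 1) {f : Circle → E} (hf : IsH2 f)
    (h0 : diskEval α f = 0) : IsH2 (fun z => conj (blaschkeFactor α z) • f z) := by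
  set g : Circle → E := fun z => ((z : ℂ) - α)⁻¹ • f z with hg
  have hgm : MemLp g 2 m := memLp_continuous_smul
    ((continuous_coe_circle.sub continuous_const).inv₀ (sub_ne_zero_of_norm_lt_one hα)) hf.1
  have hrec : ∀ n : ℤ, n < 0 →
      fourierCoefficient g (n - 1) = α • fourierCoefficient g n := by
    intro n hn
    have h1 := fourierCoefficient_affine_smul hgm (-α) 1 n
    have h2 : (fun z : Circle => (-α + 1 * (z : ℂ)) • g z) = f := by
      funext z
      rw [hg, smul_smul, one_mul, neg_add_eq_sub,
        mul_inv_cancel₀ (sub_ne_zero_of_norm_lt_one hα z), one_smul]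
    rw [h2, hf.2 n hn, one_smul, neg_smul, neg_add_eq_sub] at h1
    exact (sub_eq_zero.1 h1.symm)
  have hm1 : fourierCoefficient g (0 - 1) = 0 := by
    rw [← fourierCoefficient_zpow_smul, ← h0, diskEval_eq_fourierCoefficient]
    congr 1
    funext z
    rw [hg, smul_smul, zpow_one]
    congr 1
    rw [← div_eq_mul_inv, eq_comm, inv_eq_iff_eq_inv, inv_div, conj_coe_eq_inv]
    have := Circle.coe_ne_zero z
    field_simp
  have hneg : ∀ k : ℕ, fourierCoefficient g (-1 - k) = 0 := by
    intro k
    induction k with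
    | zero => simpa using hm1
    | succ k ih =>
      have := hrec (-1 - k) (by omega)
      rw [ih, smul_zero] at this
      rw [← this]
      congr 1
      push_cast
      ring
  have hgH : IsH2 g := ⟨hgm, fun n hn => by
    have := hneg (-1 - n).toNat
    rwa [Int.toNat_of_nonneg (by omega), sub_sub_cancel] at this⟩
  refine (hgH.affine_smul 1 (-conj α)).congr (.of_forall fun z => ?_)
  simp only [hg, smul_smul]
  rw [conj_blaschkeFactor hα, div_eq_mul_inv]
  congr 2
  ring

end BlaschkeFactor

theorem isH2_prod_blaschkeFactor_smul {M : ℕ} {α : Fin M → ℂ} (hα : ∀ i, ‖α i‖ < 1)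
    {f : Circle → E} (hf : IsH2 f) : IsH2 fun z => (∏ i, blaschkeFactor (α i) z) • f z := by
  induction M with
  | zero => simpa using hf
  | succ M ih =>
    simp only [Fin.prod_univ_succ, mul_smul]
    exact (ih fun i => hα i.succ).blaschkeFactor_smul (hα 0)

/-! ### Operator-valued `H^∞` functions act on `H²` -/

theorem inner_fourierCoefficient [CompleteSpace E] {f : Circle → E} (hf : MemLp f 2 m) (x : E)
    (n : ℤ) : ⟪x, fourierCoefficient f n⟫_ℂ = fourierCoefficient (fun z => ⟪x, f z⟫_ℂ) n :=
  (fourierCoefficient_clm (innerSL ℂ x) hf n).symm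

theorem fourierCoefficient_conj (f : Circle → ℂ) (n : ℤ) :
    fourierCoefficient (fun z => conj (f z)) n = conj (fourierCoefficient f (-n)) := by
  rw [fourierCoefficient, fourierCoefficient, ← integral_conj]
  refine integral_congr_ae (.of_forall fun z => ?_)
  simp only [smul_eq_mul, map_mul, map_zpow₀, Complex.conj_conj]
  rw [conj_coe_eq_inv, inv_zpow, zpow_neg]

theorem memLp_monomial (n : ℤ) (x : E) : MemLp (fun z : Circle => (z : ℂ) ^ n • x) 2 m :=
  memLp_continuous_smul (continuous_coe_circle.zpow₀ n fun z => Or.inl (Circle.coe_ne_zero z))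
    (memLp_const x)

/-- The monomial `zⁿ x` as an element of `L²(𝕋, E)`. -/
def monomialLp (n : ℤ) (x : E) : Lp E 2 m := (memLp_monomial n x).toLp

theorem inner_monomialLp [CompleteSpace E] (n : ℤ) (x : E) (f : Lp E 2 m) :
    ⟪monomialLp n x, f⟫_ℂ = ⟪x, fourierCoefficient f n⟫_ℂ := by
  rw [inner_fourierCoefficient (Lp.memLp f), L2.inner_def, fourierCoefficient]
  refine integral_congr_ae ?_
  filter_upwards [(memLp_monomial n x).coeFn_toLp] with z hz
  rw [monomialLp, hz, inner_smul_left, map_zpow₀, smul_eq_mul]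

theorem H2_eq_orthogonal [CompleteSpace E] :
    H2 E = (Submodule.span ℂ {g | ∃ n < 0, ∃ x : E, g = monomialLp n x})ᗮ := by
  ext f
  rw [Submodule.mem_orthogonal]
  constructor
  · intro hf u hu
    induction hu using Submodule.span_induction with
    | mem u hu =>
      obtain ⟨n, hn, x, rfl⟩ := hu
      rw [inner_monomialLp, hf n hn, inner_zero_right]
    | zero => exact inner_zero_left _
    | add u v _ _ hu hv => rw [inner_add_left, hu, hv, add_zero]
    | smul c u _ hu => rw [inner_smul_left, hu, mul_zero]
  · intro h n hn
    refine ext_inner_left ℂ fun x => ?_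
    rw [← inner_monomialLp, inner_zero_right]
    exact h _ (Submodule.subset_span ⟨n, hn, x, rfl⟩)

theorem isClosed_H2 [CompleteSpace E] : IsClosed (H2 E : Set (Lp E 2 m)) := by
  rw [H2_eq_orthogonal]
  exact Submodule.isClosed_orthogonal _

theorem isH2_monomial [CompleteSpace E] {n : ℤ} (hn : 0 ≤ n) (x : E) :
    IsH2 (fun z : Circle => (z : ℂ) ^ n • x) :=
  (isH2_const x).zpow_smul hn

theorem monomialLp_mem_H2 [CompleteSpace E] {n : ℤ} (hn : 0 ≤ n) (x : E) :
    monomialLp n x ∈ H2 E :=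
  isH2_coeFn.1 ((isH2_monomial hn x).congr (memLp_monomial n x).coeFn_toLp.symm)

/-- The analytic polynomials are dense in `H²(𝕋, E)`: an element of `H²` orthogonal to all of
them has no nonzero Fourier coefficient. -/
theorem H2_le_closure_span_monomialLp [CompleteSpace E] :
    H2 E ≤ (Submodule.span ℂ
      {g | ∃ n ≥ 0, ∃ x : E, g = monomialLp n x}).topologicalClosure := by
  set W := Submodule.span ℂ {g | ∃ n ≥ 0, ∃ x : E, g = monomialLp n x} with hW
  intro f hf
  have hWH : W.topologicalClosure ≤ H2 E := by
    refine Submodule.topologicalClosure_minimal _ (Submodule.span_le.2 ?_) isClosed_H2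
    rintro _ ⟨n, hn, x, rfl⟩
    exact monomialLp_mem_H2 hn x
  have : CompleteSpace W.topologicalClosure :=
    (Submodule.isClosed_topologicalClosure _).completeSpace_coe
  obtain ⟨p, hp, g, hg, rfl⟩ := W.topologicalClosure.exists_add_mem_mem_orthogonal f
  have hgH : g ∈ H2 E := by
    have := (H2 E).sub_mem hf (hWH hp)
    rwa [add_sub_cancel_left] at this
  have hg0 : g = 0 := by
    refine (Lp.eq_zero_iff_ae_eq_zero).2
      (ae_eq_zero_of_fourierCoefficient_eq_zero (Lp.memLp g) fun n => ?_)
    rcases lt_or_ge n 0 with hn | hn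
    · exact hgH n hn
    · refine ext_inner_left ℂ fun x => ?_
      rw [← inner_monomialLp, inner_zero_right]
      exact (Submodule.mem_orthogonal _ _).1 hg _
        (Submodule.le_topologicalClosure _ (Submodule.subset_span ⟨n, hn, x, rfl⟩))
  rwa [hg0, add_zero]

theorem coeFn_multiplication {Ψ : Circle → D →L[ℂ] E} (hΨ : IsLinfty Ψ) (f : Lp D 2 m) :
    multiplication Ψ hΨ f =ᵐ[m] fun z => Ψ z (f z) :=
  (hΨ.memLp_apply f).coeFn_toLp

theorem continuous_multiplication {Ψ : Circle → D →L[ℂ] E} (hΨ : IsLinfty Ψ) :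
    Continuous (multiplication Ψ hΨ) := by
  obtain ⟨C, hC⟩ := hΨ.2
  refine AddMonoidHomClass.continuous_of_bound _ C fun f => ?_
  refine Lp.norm_le_mul_norm_of_ae_le_mul ?_
  filter_upwards [coeFn_multiplication hΨ f, hC] with z hz hCz
  rw [hz]
  exact (Ψ z).le_of_opNorm_le hCz _

theorem IsHinfty.isH2_apply_const {Φ : Circle → D →L[ℂ] E} (hΦ : IsHinfty Φ) (x : D) :
    IsH2 (fun z => Φ z x) := by
  refine ⟨?_, fun n hn => hΦ.2 n hn x⟩
  obtain ⟨C, hC⟩ := hΦ.1.2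
  refine MemLp.of_bound (hΦ.1.1 x) (C * ‖x‖) ?_
  filter_upwards [hC] with z hz
  exact (Φ z).le_of_opNorm_le hz _

theorem isHinfty_iff {Φ : Circle → D →L[ℂ] E} :
    IsHinfty Φ ↔ IsLinfty Φ ∧ ∀ x, IsH2 (fun z => Φ z x) :=
  ⟨fun h => ⟨h.1, h.isH2_apply_const⟩, fun h => ⟨h.1, fun n hn x => (h.2 x).2 n hn⟩⟩

/-- `Φ H² ⊆ H²` for `Φ ∈ H^∞`, by density of the analytic polynomials. -/
theorem IsHinfty.isH2_apply [CompleteSpace D] [CompleteSpace E] {Φ : Circle → D →L[ℂ] E}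
    (hΦ : IsHinfty Φ) {f : Circle → D} (hf : IsH2 f) : IsH2 (fun z => Φ z (f z)) := by
  have key : H2 D ≤ (H2 E).comap (multiplication Φ hΦ.1) := by
    refine H2_le_closure_span_monomialLp.trans (Submodule.topologicalClosure_minimal _
      (Submodule.span_le.2 ?_) (isClosed_H2.preimage (continuous_multiplication hΦ.1)))
    rintro _ ⟨n, hn, x, rfl⟩
    refine isH2_coeFn.1 (((hΦ.isH2_apply_const x).zpow_smul hn).congr ?_)
    filter_upwards [coeFn_multiplication hΦ.1 (monomialLp n x),
      (memLp_monomial n x).coeFn_toLp] with z h1 h2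
    rw [h1, monomialLp, h2, map_smul]
  have hfH : hf.1.toLp ∈ H2 D := isH2_coeFn.1 (hf.congr hf.1.coeFn_toLp.symm)
  refine (isH2_coeFn.2 (key hfH)).congr ?_
  filter_upwards [coeFn_multiplication hΦ.1 hf.1.toLp, hf.1.coeFn_toLp] with z h1 h2
  rw [h1, h2]

theorem blaschkeFactor_smul_conj_smul {α : ℂ} (hα : ‖α‖ < 1) (z : Circle) (x : E) :
    blaschkeFactor α z • conj (blaschkeFactor α z) • x = x := by
  rw [smul_smul, mul_comm, conj_blaschkeFactor_mul_self hα, one_smul]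

theorem conj_smul_blaschkeFactor_smul {α : ℂ} (hα : ‖α‖ < 1) (z : Circle) (x : E) :
    conj (blaschkeFactor α z) • blaschkeFactor α z • x = x := by
  rw [smul_smul, conj_blaschkeFactor_mul_self hα, one_smul]

/-- Evaluation at a point of the disc is multiplicative: `(Φ f)(α) = Φ(α) f(α)`. -/
theorem IsHinfty.diskEval_apply [CompleteSpace D] [CompleteSpace E] {Φ : Circle → D →L[ℂ] E}
    (hΦ : IsHinfty Φ) {α : ℂ} (hα : ‖α‖ < 1) {f : Circle → D} (hf : IsH2 f) :
    diskEval α (fun z => Φ z (f z)) = diskEval α (fun z => Φ z (diskEval α f)) := by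
  set c := diskEval α f with hc
  have hh : IsH2 (fun z => f z + -c) := hf.add (isH2_const (-c))
  have hh0 : diskEval α (fun z => f z + -c) = 0 := by
    rw [diskEval_add hα hf.1 (memLp_const _), diskEval_const hα, ← hc, add_neg_cancel]
  have hΦg := hΦ.isH2_apply (hh.conj_blaschkeFactor_smul hα hh0)
  have hdec : (fun z => Φ z (f z)) = fun z => Φ z c + blaschkeFactor α z •
      Φ z (conj (blaschkeFactor α z) • (f z + -c)) := by
    funext z
    rw [map_smul, blaschkeFactor_smul_conj_smul hα, ← map_add]
    congr 1
    abel
  rw [hdec, diskEval_add hα (hΦ.isH2_apply_const c).1 (hΦg.blaschkeFactor_smul hα).1,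
    diskEval_blaschkeFactor_smul hα hΦg, add_zero]

theorem IsHinfty.exists_norm_diskEval_le {Φ : Circle → D →L[ℂ] E} (hΦ : IsHinfty Φ) {α : ℂ}
    (hα : ‖α‖ < 1) : ∃ C : ℝ, ∀ x, ‖diskEval α (fun z => Φ z x)‖ ≤ C * ‖x‖ := by
  obtain ⟨C, hC⟩ := hΦ.1.2
  obtain ⟨K, hK⟩ := isCompact_univ.exists_bound_of_continuousOn
    (continuous_cauchyKernel hα).continuousOn
  refine ⟨K * C, fun x => ?_⟩
  have := norm_integral_le_of_norm_le_const (μ := m) (C := K * C * ‖x‖)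
    (f := fun z : Circle => (1 - α * conj (z : ℂ))⁻¹ • Φ z x) (by
      filter_upwards [hC] with z hz
      rw [norm_smul, mul_assoc]
      exact mul_le_mul (hK z (Set.mem_univ z)) ((Φ z).le_of_opNorm_le hz _) (norm_nonneg _)
        ((norm_nonneg _).trans (hK z (Set.mem_univ z))))
  simpa [diskEval] using this

/-- The value `Φ(α)` at `α ∈ 𝔻` of the holomorphic extension of `Φ ∈ H^∞`. -/
def IsHinfty.diskEvalCLM {Φ : Circle → D →L[ℂ] E} (hΦ : IsHinfty Φ) {α : ℂ} (hα : ‖α‖ < 1) :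
    D →L[ℂ] E :=
  LinearMap.mkContinuousOfExistsBound
    { toFun := fun x => diskEval α (fun z => Φ z x)
      map_add' := fun x y => by
        simp only [map_add]
        exact diskEval_add hα (hΦ.isH2_apply_const x).1 (hΦ.isH2_apply_const y).1
      map_smul' := fun c x => by
        simp only [map_smul]
        exact diskEval_const_smul _ c }
    (hΦ.exists_norm_diskEval_le hα)

theorem IsHinfty.diskEvalCLM_apply {Φ : Circle → D →L[ℂ] E} (hΦ : IsHinfty Φ) {α : ℂ}
    (hα : ‖α‖ < 1) (x : D) : hΦ.diskEvalCLM hα x = diskEval α (fun z => Φ z x) := rfl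

/-! ### Unitary-valued functions and Potapov factors -/

theorem potapovFactor_apply (α : ℂ) (P : E →L[ℂ] E) (z : Circle) (x : E) :
    potapovFactor α P z x = blaschkeFactor α z • P x + (1 - P) x := rfl

theorem smul_add_one_sub_mul_smul_add_one_sub {P : E →L[ℂ] E} (hP : IsIdempotentElem P)
    {c d : ℂ} (h : c * d = 1) : (c • P + (1 - P)) * (d • P + (1 - P)) = 1 := by
  ext x
  have hx : P (P x) = P x := congrArg (fun A : E →L[ℂ] E => A x) hP.eq
  change c • P (d • P x + (x - P x)) + ((d • P x + (x - P x)) - P (d • P x + (x - P x))) = x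
  simp only [map_add, map_smul, map_sub, hx]
  rw [sub_self, add_zero, smul_smul, h, one_smul]
  abel

theorem isLinfty_of_adjoint_comp_self [CompleteSpace D] [CompleteSpace E] {Φ : Circle → D →L[ℂ] E}
    (hmeas : ∀ x, AEStronglyMeasurable (fun z => Φ z x) m)
    (h : ∀ᵐ z ∂m, (Φ z)† ∘L Φ z = 1) : IsLinfty Φ := by
  refine ⟨hmeas, 1, ?_⟩
  filter_upwards [h] with z hz
  refine ContinuousLinearMap.opNorm_le_bound _ zero_le_one fun x => ?_
  rw [((Φ z).norm_map_iff_adjoint_comp_self).2 hz x, one_mul]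

/-- If both `Φ` and `Φ*` are analytic then `Φ` is constant. -/
theorem IsHinfty.ae_eq_diskEvalCLM_zero [CompleteSpace D] [CompleteSpace E]
    {Φ : Circle → D →L[ℂ] E} (hΦ : IsHinfty Φ)
    (hΦ' : IsHinfty fun z => (Φ z)†) (x : D) :
    ∀ᵐ z ∂m, Φ z x = hΦ.diskEvalCLM (α := 0) (by simp) x := by
  have hx := hΦ.isH2_apply_const x
  set c := fourierCoefficient (fun z => Φ z x) 0 with hc
  have hpos : ∀ n : ℤ, 0 < n → fourierCoefficient (fun z => Φ z x) n = 0 := by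
    intro n hn
    refine ext_inner_left ℂ fun y => ?_
    have hy := hΦ'.isH2_apply_const y
    have h1 : (fun z => ⟪y, Φ z x⟫_ℂ) = fun z => conj (⟪x, ((Φ z)†) y⟫_ℂ) := by
      funext z
      rw [inner_conj_symm, adjoint_inner_left]
    rw [inner_fourierCoefficient hx.1, h1, fourierCoefficient_conj,
      ← inner_fourierCoefficient hy.1, hy.2 (-n) (by omega), inner_zero_right, map_zero,
      inner_zero_right]
  have hae : (fun z => Φ z x + -c) =ᵐ[m] 0 := by
    refine ae_eq_zero_of_fourierCoefficient_eq_zero (hx.1.add (memLp_const _)) fun n => ?_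
    rw [fourierCoefficient_add hx.1 (memLp_const _), fourierCoefficient_const]
    rcases lt_trichotomy n 0 with hn | rfl | hn
    · rw [hx.2 n hn, if_neg hn.ne, add_zero]
    · rw [if_pos rfl, ← hc, add_neg_cancel]
    · rw [hpos n hn, if_neg hn.ne', add_zero]
  have hae' : (fun z => Φ z x) =ᵐ[m] fun _ => c := by
    filter_upwards [hae] with z hz
    exact add_neg_eq_zero.1 hz
  rw [hΦ.diskEvalCLM_apply, diskEval_congr_ae hae', diskEval_const (by simp)]
  exact hae'

theorem exists_unitary_of_isHinfty_adjoint [CompleteSpace E]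
    {Φ : Circle → E →L[ℂ] E} (hΦ : IsHinfty Φ)
    (hΦ' : IsHinfty fun z => (Φ z)†) (h1 : ∀ᵐ z ∂m, (Φ z)† ∘L Φ z = 1)
    (h2 : ∀ᵐ z ∂m, Φ z ∘L (Φ z)† = 1) :
    ∃ V ∈ unitary (E →L[ℂ] E), StrongEq Φ fun _ => V := by
  set V := hΦ.diskEvalCLM (α := 0) (by simp) with hV
  set W := hΦ'.diskEvalCLM (α := 0) (by simp) with hW
  have hVx := hΦ.ae_eq_diskEvalCLM_zero hΦ'
  have hWx := hΦ'.ae_eq_diskEvalCLM_zero (by simpa using hΦ)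
  rw [← hV] at hVx
  rw [← hW] at hWx
  have hadj : V† = W := by
    refine ((eq_adjoint_iff _ _).2 fun y x => ?_).symm
    obtain ⟨z, hz1, hz2⟩ := ((hVx x).and (hWx y)).exists
    rw [← hz1, ← hz2, adjoint_inner_left]
  refine ⟨V, ?_, hVx⟩
  rw [Unitary.mem_iff, star_eq_adjoint, hadj]
  constructor
  · ext x
    obtain ⟨z, hz1, hz2, hz3⟩ := ((hVx x).and ((hWx (V x)).and h1)).exists
    rw [mul_apply_eq_comp, ← hz2, ← hz1]
    exact congrArg (fun A : E →L[ℂ] E => A x) hz3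
  · ext x
    obtain ⟨z, hz1, hz2, hz3⟩ := ((hWx x).and ((hVx (W x)).and h2)).exists
    rw [mul_apply_eq_comp, ← hz2, ← hz1]
    exact congrArg (fun A : E →L[ℂ] E => A x) hz3

section PotapovFactor

variable {α : ℂ} {P : E →L[ℂ] E}

theorem adjoint_potapovFactor [CompleteSpace E] (hP : IsStarProjection P) (z : Circle) :
    (potapovFactor α P z)† = conj (blaschkeFactor α z) • P + (1 - P) := by
  have h : star P = P := hP.isSelfAdjoint
  rw [← star_eq_adjoint, potapovFactor, star_add, star_smul, star_sub, h, star_one]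
  rfl

theorem adjoint_potapovFactor_apply [CompleteSpace E]
    (hP : IsStarProjection P) (z : Circle) (x : E) :
    ((potapovFactor α P z)†) x = conj (blaschkeFactor α z) • P x + (1 - P) x := by
  rw [adjoint_potapovFactor hP]
  rfl

theorem potapovFactor_mul_adjoint [CompleteSpace E]
    (hα : ‖α‖ < 1) (hP : IsStarProjection P) (z : Circle) :
    potapovFactor α P z * (potapovFactor α P z)† = 1 := by
  rw [adjoint_potapovFactor hP, potapovFactor]
  refine smul_add_one_sub_mul_smul_add_one_sub hP.isIdempotentElem ?_
  rw [mul_comm, conj_blaschkeFactor_mul_self hα]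

theorem adjoint_mul_potapovFactor [CompleteSpace E]
    (hα : ‖α‖ < 1) (hP : IsStarProjection P) (z : Circle) :
    (potapovFactor α P z)† * potapovFactor α P z = 1 := by
  rw [adjoint_potapovFactor hP, potapovFactor]
  exact smul_add_one_sub_mul_smul_add_one_sub hP.isIdempotentElem
    (conj_blaschkeFactor_mul_self hα z)

end PotapovFactor

/-! ### Factorization of rational two-sided inner functions -/

/-- Extraction of the rightmost Potapov factor. With `P` the orthogonal projection onto
`ker Φ(α)`, the quotient `Φ (b_α P + (I - P))*` is still analytic because `Φ(α) P = 0`. If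
`b_α θ Φ*` maps `H²` into itself, then so does `θ` times the adjoint of the quotient, because
the values at `α` of the functions `b_α θ Φ* f` lie in `ker Φ(α)`. -/
theorem exists_potapovFactor_right [CompleteSpace E] {α : ℂ} (hα : ‖α‖ < 1) {θ : Circle → ℂ}
    (hθ : ∀ f : Circle → E, IsH2 f → IsH2 fun z => θ z • f z)
    {Φ : Circle → E →L[ℂ] E} (hΦ : IsHinfty Φ)
    (hmeas : ∀ x, AEStronglyMeasurable (fun z => ((Φ z)†) x) m)
    (h1 : ∀ᵐ z ∂m, (Φ z)† ∘L Φ z = 1) (h2 : ∀ᵐ z ∂m, Φ z ∘L (Φ z)† = 1)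
    (hrat : ∀ f : Circle → E, IsH2 f →
      IsH2 fun z => (blaschkeFactor α z * θ z) • ((Φ z)†) (f z)) :
    ∃ P : E →L[ℂ] E, IsStarProjection P ∧ ∃ Φ' : Circle → E →L[ℂ] E,
      (∀ z, Φ z = Φ' z * potapovFactor α P z) ∧ IsHinfty Φ' ∧
      (∀ x, AEStronglyMeasurable (fun z => ((Φ' z)†) x) m) ∧
      (∀ᵐ z ∂m, (Φ' z)† ∘L Φ' z = 1) ∧ (∀ᵐ z ∂m, Φ' z ∘L (Φ' z)† = 1) ∧
      ∀ f : Circle → E, IsH2 f → IsH2 fun z => θ z • ((Φ' z)†) (f z) := by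
  set N : Submodule ℂ E := LinearMap.ker (hΦ.diskEvalCLM hα).toLinearMap with hN
  have hNc : CompleteSpace N := (hΦ.diskEvalCLM hα).isClosed_ker.completeSpace_coe
  have hNmem : ∀ x, x ∈ N ↔ diskEval α (fun z => Φ z x) = 0 := fun x => Iff.rfl
  set P : E →L[ℂ] E := N.starProjection with hPdef
  have hP : IsStarProjection P := isStarProjection_starProjection
  refine ⟨P, hP, fun z => Φ z * (potapovFactor α P z)†, fun z => ?_, ?_⟩
  · rw [mul_assoc, adjoint_mul_potapovFactor hα hP, mul_one]
  have hadj : ∀ z, ((Φ z * (potapovFactor α P z)†)†) = potapovFactor α P z * (Φ z)† := by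
    intro z
    simp only [← star_eq_adjoint, star_mul, star_star]
  have hb := (continuous_blaschkeFactor hα).measurable.aestronglyMeasurable (μ := m)
  have hbc := (Complex.continuous_conj.comp
    (continuous_blaschkeFactor hα)).measurable.aestronglyMeasurable (μ := m)
  have happ : ∀ z x, (Φ z * (potapovFactor α P z)†) x
      = conj (blaschkeFactor α z) • Φ z (P x) + Φ z ((1 - P) x) := by
    intro z x
    rw [mul_apply_eq_comp, adjoint_potapovFactor_apply hP, map_add, map_smul]
  have h1' : ∀ᵐ z ∂m,
      ((Φ z * (potapovFactor α P z)†)†) ∘L (Φ z * (potapovFactor α P z)†) = 1 := by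
    filter_upwards [h1] with z hz
    rw [hadj, ← ContinuousLinearMap.mul_def, mul_assoc, ← mul_assoc _ (Φ z),
      ContinuousLinearMap.mul_def ((Φ z)†), hz, one_mul, potapovFactor_mul_adjoint hα hP]
  have h2' : ∀ᵐ z ∂m,
      (Φ z * (potapovFactor α P z)†) ∘L ((Φ z * (potapovFactor α P z)†)†) = 1 := by
    filter_upwards [h2] with z hz
    rw [hadj, ← ContinuousLinearMap.mul_def, mul_assoc, ← mul_assoc _ _ ((Φ z)†),
      adjoint_mul_potapovFactor hα hP, one_mul, ContinuousLinearMap.mul_def, hz]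
  refine ⟨isHinfty_iff.2 ⟨isLinfty_of_adjoint_comp_self (fun x => ?_) h1', fun x => ?_⟩,
    fun x => ?_, h1', h2', fun f hf => ?_⟩
  · simp only [happ]
    exact (hbc.smul (hΦ.1.1 _)).add (hΦ.1.1 _)
  · simp only [happ]
    refine ((hΦ.isH2_apply_const (P x)).conj_blaschkeFactor_smul hα ?_).add
      (hΦ.isH2_apply_const _)
    exact (hNmem _).1 (N.starProjection_apply_mem x)
  · simp only [hadj, mul_apply_eq_comp, potapovFactor_apply]
    exact (hb.smul (P.continuous.comp_aestronglyMeasurable (hmeas x))).add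
      ((1 - P).continuous.comp_aestronglyMeasurable (hmeas x))
  · set h : Circle → E := fun z => (blaschkeFactor α z * θ z) • ((Φ z)†) (f z) with hh
    have hhH : IsH2 h := hrat f hf
    -- `Φ h = b_α θ f` vanishes at `α`, hence `h(α) ∈ ker Φ(α)`.
    have hker : diskEval α h ∈ N := by
      rw [hNmem, ← hΦ.diskEval_apply hα hhH,
        ← diskEval_blaschkeFactor_smul hα (hθ f hf)]
      refine diskEval_congr_ae ?_
      filter_upwards [h2] with z hz
      rw [hh, map_smul, mul_smul]
      congr 2
      exact congrArg (fun A : E →L[ℂ] E => A (f z)) hz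
    have h0 : diskEval α (fun z => (1 - P) (h z)) = 0 := by
      rw [diskEval_clm hα _ hhH.1, sub_apply, one_apply_eq_self,
        hPdef, N.starProjection_eq_self_iff.2 hker, sub_self]
    refine ((hhH.clm P).add ((hhH.clm (1 - P)).conj_blaschkeFactor_smul hα h0)).congr
      (.of_forall fun z => ?_)
    simp only [hadj, mul_apply_eq_comp, potapovFactor_apply, hh, map_smul, mul_smul,
      conj_smul_blaschkeFactor_smul hα, smul_add]
    rw [smul_comm (θ z)]

theorem exists_blaschkePotapov_of_isH2 [CompleteSpace E]
    {M : ℕ} {α : Fin M → ℂ} (hα : ∀ i, ‖α i‖ < 1)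
    {Φ : Circle → E →L[ℂ] E} (hΦ : IsHinfty Φ)
    (hmeas : ∀ x, AEStronglyMeasurable (fun z => ((Φ z)†) x) m)
    (h1 : ∀ᵐ z ∂m, (Φ z)† ∘L Φ z = 1) (h2 : ∀ᵐ z ∂m, Φ z ∘L (Φ z)† = 1)
    (hrat : ∀ f : Circle → E, IsH2 f →
      IsH2 fun z => (∏ i, blaschkeFactor (α i) z) • ((Φ z)†) (f z)) :
    ∃ V ∈ unitary (E →L[ℂ] E), ∃ P : Fin M → E →L[ℂ] E, (∀ i, IsStarProjection (P i)) ∧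
      StrongEq Φ fun z => V * (List.ofFn fun i => potapovFactor (α i) (P i) z).prod := by
  induction M generalizing Φ with
  | zero =>
    have hΦ' : IsHinfty fun z => (Φ z)† := by
      refine isHinfty_iff.2 ⟨isLinfty_of_adjoint_comp_self hmeas (by simpa using h2), fun x => ?_⟩
      simpa using hrat _ (isH2_const x)
    obtain ⟨V, hV, hVΦ⟩ := exists_unitary_of_isHinfty_adjoint hΦ hΦ' h1 h2
    exact ⟨V, hV, Fin.elim0, fun i => i.elim0, by simpa using hVΦ⟩
  | succ M ih =>
    obtain ⟨Q, hQ, Φ', hfac, hΦ', hmeas', h1', h2', hrat'⟩ :=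
      exists_potapovFactor_right (hα (Fin.last M))
        (θ := fun z => ∏ i : Fin M, blaschkeFactor (α i.castSucc) z)
        (fun f hf => isH2_prod_blaschkeFactor_smul (fun i => hα i.castSucc) hf) hΦ hmeas h1 h2
        (fun f hf => by
          have := hrat f hf
          simp only [Fin.prod_univ_castSucc] at this
          simpa only [mul_comm] using this)
    obtain ⟨V, hV, P, hP, heq⟩ := ih (fun i => hα i.castSucc) hΦ' hmeas' h1' h2' hrat'
    refine ⟨V, hV, Fin.snoc (α := fun _ => E →L[ℂ] E) P Q, fun i => ?_, fun x => ?_⟩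
    · refine Fin.lastCases ?_ (fun j => ?_) i
      · simpa using hQ
      · simpa using hP j
    · filter_upwards [heq (Q x), heq ((1 - Q) x)] with z hz1 hz2
      rw [hfac z, List.ofFn_succ']
      simp only [Fin.snoc_castSucc, Fin.snoc_last, List.concat_eq_append, List.prod_append,
        List.prod_singleton]
      rw [← mul_assoc, mul_apply_eq_comp, mul_apply_eq_comp,
        potapovFactor_apply, map_add, map_add, map_smul, map_smul, hz1, hz2]

/-! ### Blaschke-Potapov products are rational -/

theorem StrongEq.ae_apply_eq {A B : Circle → D →L[ℂ] E} (h : StrongEq A B) {f : Circle → D}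
    (hf : AEStronglyMeasurable f m) : ∀ᵐ z ∂m, A z (f z) = B z (f z) := by
  obtain ⟨t, ⟨c, hc, htc⟩, hft⟩ := hf.isSeparable_ae_range
  have hae : ∀ᵐ z ∂m, ∀ x ∈ c, A z x = B z x := (ae_ball_iff hc).2 fun x _ => h x
  filter_upwards [hae, hft] with z hz hfz
  exact Set.EqOn.closure (s := c) hz (A z).continuous (B z).continuous (htc hfz)

/-- If `Φ` is isometric almost everywhere and `Δ` is coisometric with `Δ*` strongly continuous,
strong equality passes to the adjoints. For nonseparable `E` this uses that the orbit `Δ(·)* y` has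
separable range, so that `Φ(z) Δ(z)* y = Δ(z) Δ(z)* y = y` for almost every `z`. -/
theorem StrongEq.adjoint [CompleteSpace E] {Φ Δ : Circle → E →L[ℂ] E} (h : StrongEq Φ Δ)
    (h1 : ∀ᵐ z ∂m, (Φ z)† ∘L Φ z = 1) (hΔ : ∀ z, Δ z * (Δ z)† = 1)
    (hc : ∀ y, Continuous fun z => ((Δ z)†) y) :
    StrongEq (fun z => (Φ z)†) fun z => (Δ z)† := by
  intro y
  filter_upwards [h.ae_apply_eq (hc y).aestronglyMeasurable, h1] with z hz h1z
  have h2 : Δ z (((Δ z)†) y) = y := congrArg (fun A : E →L[ℂ] E => A y) (hΔ z)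
  have h3 : ((Φ z)†) (Φ z (((Δ z)†) y)) = ((Δ z)†) y :=
    congrArg (fun A : E →L[ℂ] E => A (((Δ z)†) y)) h1z
  rwa [hz, h2] at h3

theorem adjoint_mul_eq [CompleteSpace E] (A B : E →L[ℂ] E) : (A * B)† = B† * A† := adjoint_comp A B

theorem prod_potapovFactor_mul_adjoint [CompleteSpace E]
    {M : ℕ} {α : Fin M → ℂ} (hα : ∀ i, ‖α i‖ < 1)
    {P : Fin M → E →L[ℂ] E} (hP : ∀ i, IsStarProjection (P i)) (z : Circle) :
    (List.ofFn fun i => potapovFactor (α i) (P i) z).prod *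
      ((List.ofFn fun i => potapovFactor (α i) (P i) z).prod†) = 1 := by
  induction M with
  | zero => simp [← star_eq_adjoint]
  | succ M ih =>
    rw [List.ofFn_succ, List.prod_cons, adjoint_mul_eq, mul_assoc, ← mul_assoc _ _ (_†),
      ih (fun i => hα i.succ) (fun i => hP i.succ), one_mul,
      potapovFactor_mul_adjoint (hα 0) (hP 0)]

theorem continuous_adjoint_prod_potapovFactor [CompleteSpace E]
    {M : ℕ} {α : Fin M → ℂ} (hα : ∀ i, ‖α i‖ < 1)
    (P : Fin M → E →L[ℂ] E) :
    Continuous fun z => ((List.ofFn fun i => potapovFactor (α i) (P i) z).prod†) := by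
  refine (ContinuousLinearMap.adjoint (𝕜 := ℂ) (E := E) (F := E)).continuous.comp ?_
  induction M with
  | zero => simpa using continuous_const
  | succ M ih =>
    simp only [List.ofFn_succ, List.prod_cons]
    refine Continuous.mul ?_ (ih (fun i => hα i.succ) _)
    exact ((continuous_blaschkeFactor (hα 0)).smul continuous_const).add continuous_const

/-- With `θ = ∏ b_{α_i}`, each `b_{α_i} (b_{α_i} P_i + (I - P_i))* = P_i + b_{α_i} (I - P_i)` is
analytic, hence so is `θ Δ*`. -/
theorem isH2_prod_smul_adjoint_prod_potapovFactor [CompleteSpace E] {M : ℕ} {α : Fin M → ℂ}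
    (hα : ∀ i, ‖α i‖ < 1) {P : Fin M → E →L[ℂ] E} (hP : ∀ i, IsStarProjection (P i))
    {f : Circle → E} (hf : IsH2 f) :
    IsH2 fun z => (∏ i, blaschkeFactor (α i) z) •
      ((List.ofFn fun i => potapovFactor (α i) (P i) z).prod†) (f z) := by
  induction M generalizing f with
  | zero => simpa [← star_eq_adjoint] using hf
  | succ M ih =>
    have hg : IsH2 fun z => P 0 (f z) + blaschkeFactor (α 0) z • (1 - P 0) (f z) :=
      (hf.clm (P 0)).add ((hf.clm (1 - P 0)).blaschkeFactor_smul (hα 0))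
    refine (ih (fun i => hα i.succ) (fun i => hP i.succ) hg).congr (.of_forall fun z => ?_)
    simp only [Fin.prod_univ_succ, List.ofFn_succ, List.prod_cons, adjoint_mul_eq,
      mul_apply_eq_comp, adjoint_potapovFactor_apply (hP 0)]
    rw [mul_comm, mul_smul]
    simp only [map_add, map_smul, smul_add, blaschkeFactor_smul_conj_smul (hα 0)]

/-! ### Kernels of Hankel operators -/

theorem flip_injective : Function.Injective (flip E) := by
  intro f g hfg
  have h1 : (Lp.compMeasurePreservingₗᵢ ℂ (fun z : Circle => z⁻¹) measurePreserving_inv) f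
      = (Lp.compMeasurePreservingₗᵢ ℂ (E := E) (p := 2) (fun z : Circle => z⁻¹)
        measurePreserving_inv) g := by
    refine Lp.ext ?_
    have h2 := Lp.ext_iff.1 hfg
    filter_upwards [h2, coeFn_multiplication (E := E) isLinfty_conj
      (Lp.compMeasurePreservingₗᵢ ℂ (fun z : Circle => z⁻¹) measurePreserving_inv f),
      coeFn_multiplication (E := E) isLinfty_conj
      (Lp.compMeasurePreservingₗᵢ ℂ (fun z : Circle => z⁻¹) measurePreserving_inv g)]
      with z hz hf hg
    have h3 := hf.symm.trans (hz.trans hg)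
    simp only [smul_apply, one_apply_eq_self] at h3
    exact smul_right_injective E (by simp : conj (z : ℂ) ≠ 0) h3
  exact (Lp.compMeasurePreservingₗᵢ ℂ _ measurePreserving_inv).injective h1

theorem hankel_eq_zero_iff [CompleteSpace E] {Ψ : Circle → D →L[ℂ] E} (hΨ : IsLinfty Ψ) (f : H2 D) :
    hankel Ψ hΨ f = 0 ↔ IsH2 fun z => Ψ z ((f : Lp D 2 m) z) := by
  have : CompleteSpace (H2 E) := isClosed_H2.completeSpace_coe
  have h1 : hankel Ψ hΨ f = flip E (projMinus E (multiplication Ψ hΨ f)) := rfl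
  rw [h1, map_eq_zero_iff _ flip_injective, projMinus, Submodule.starProjection_apply_eq_zero_iff,
    Submodule.orthogonal_orthogonal, ← isH2_coeFn]
  exact ⟨fun h => h.congr (coeFn_multiplication hΨ _),
    fun h => h.congr (coeFn_multiplication hΨ _).symm⟩

/-- Rationality expressed by functions: `θ Φ*` maps `H²` into itself. -/
theorem isRational_iff [CompleteSpace D] [CompleteSpace E] {Φ : Circle → D →L[ℂ] E} :
    IsRational Φ ↔ IsLinfty (fun z => (Φ z)†) ∧
      ∃ (M : ℕ) (α : Fin M → ℂ), (∀ i, ‖α i‖ < 1) ∧ ∀ f : Circle → E, IsH2 f →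
        IsH2 fun z => (∏ i, blaschkeFactor (α i) z) • ((Φ z)†) (f z) := by
  constructor
  · rintro ⟨hΦ, θ, ⟨ν, M, α, hν, hα, hθ⟩, h⟩
    refine ⟨hΦ, M, α, hα, fun f hf => ?_⟩
    have hfH : hf.1.toLp ∈ H2 E := isH2_coeFn.1 (hf.congr hf.1.coeFn_toLp.symm)
    obtain ⟨g, hg, hgf⟩ := h ⟨_, hfH, rfl⟩
    have hgH := (hankel_eq_zero_iff hΦ g).1 hg
    have hgf' : (g : Lp E 2 m) = _ := hgf
    rw [hgf'] at hgH
    refine (hgH.const_smul ν⁻¹).congr ?_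
    filter_upwards [coeFn_multiplication (IsFiniteBlaschkeProduct.isLinfty (E := E)
      ⟨ν, M, α, hν, hα, hθ⟩) hf.1.toLp, hf.1.coeFn_toLp] with z h1 h2
    have hν0 : ν ≠ 0 := by
      rintro rfl
      simp at hν
    rw [h1, h2, hθ]
    simp only [smul_apply, one_apply_eq_self, map_smul, smul_smul]
    rw [inv_mul_cancel_left₀ hν0]
  · rintro ⟨hΦ, M, α, hα, h⟩
    have hθ : IsFiniteBlaschkeProduct fun z => ∏ i, blaschkeFactor (α i) z :=
      ⟨1, M, α, norm_one, hα, fun z => (one_mul _).symm⟩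
    refine ⟨hΦ, _, hθ, ?_⟩
    rintro _ ⟨f, hf, rfl⟩
    have hf' : IsH2 (f : Circle → E) := isH2_coeFn.2 hf
    have hm := coeFn_multiplication (hθ.isLinfty (E := E)) f
    have hθf : multiplication _ (hθ.isLinfty (E := E)) f ∈ H2 E := by
      refine isH2_coeFn.1 ((isH2_prod_blaschkeFactor_smul hα hf').congr ?_)
      filter_upwards [hm] with z hz
      rw [hz]
      rfl
    refine ⟨⟨_, hθf⟩, (hankel_eq_zero_iff hΦ _).2 ((h f hf').congr ?_), rfl⟩
    filter_upwards [hm] with z hz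
    simp only [hz, smul_apply, one_apply_eq_self, map_smul]

end OperatorHardy

end

theorem corollary3p7 {E : Type*} [NormedAddCommGroup E] [InnerProductSpace ℂ E] [CompleteSpace E]
    (Φ : Circle → E →L[ℂ] E) (hΦ : OperatorHardy.IsTwoSidedInner Φ) :
    OperatorHardy.IsRational Φ ↔
      ∃ Δ : Circle → E →L[ℂ] E,
        OperatorHardy.IsFiniteBlaschkePotapovProduct Δ ∧ OperatorHardy.StrongEq Φ Δ := by
  obtain ⟨hΦ, h1, h2⟩ := hΦ
  rw [OperatorHardy.isRational_iff]
  constructor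
  · rintro ⟨hadj, M, α, hα, hrat⟩
    obtain ⟨V, hV, P, hP, heq⟩ :=
      OperatorHardy.exists_blaschkePotapov_of_isH2 hα hΦ hadj.1 h1 h2 hrat
    exact ⟨_, ⟨V, M, α, P, hV, hα, hP, fun _ => rfl⟩, heq⟩
  · rintro ⟨Δ, ⟨V, M, α, P, hV, hα, hP, hΔ⟩, heq⟩
    obtain rfl := funext hΔ
    have hstar := heq.adjoint h1
      (fun z => by
        rw [OperatorHardy.adjoint_mul_eq, mul_assoc, ← mul_assoc _ _ (V†),
          OperatorHardy.prod_potapovFactor_mul_adjoint hα hP, one_mul]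
        exact Unitary.mul_star_self_of_mem hV)
      (fun y => by
        simp only [OperatorHardy.adjoint_mul_eq]
        exact (OperatorHardy.continuous_adjoint_prod_potapovFactor hα P).clm_apply
          continuous_const)
    have hmeas : ∀ y, AEStronglyMeasurable (fun z => ((Φ z)†) y) OperatorHardy.m := by
      intro y
      refine AEStronglyMeasurable.congr ?_ ((hstar y).mono fun z hz => hz.symm)
      simp only [OperatorHardy.adjoint_mul_eq]
      exact ((OperatorHardy.continuous_adjoint_prod_potapovFactor hα P).clm_apply
        continuous_const).aestronglyMeasurable
    refine ⟨OperatorHardy.isLinfty_of_adjoint_comp_self hmeas (by simpa using h2), M, α, hα,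
      fun f hf => ?_⟩
    refine (OperatorHardy.isH2_prod_smul_adjoint_prod_potapovFactor hα hP (hf.clm (V†))).congr ?_
    filter_upwards [hstar.ae_apply_eq hf.1.1] with z hz
    rw [hz, OperatorHardy.adjoint_mul_eq]
    rfl
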